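/- Conventions. A function $f:\mathbb R\to\mathbb C$, integrable on every bounded interval, is $B$-almost periodic ($B$-a.p.) if there are trigonometric sums $\tau_N(x)=\sum_j a_j e^{i\xi_j x}$ (finite sums, $a_j\in\mathbb C$, $\xi_j\in\mathbb R$) with $\varlimsup_{T\to\infty}\frac1{2T}\int_{-T}^{T}|f-\tau_N|\,dx\to0$ as $N\to\infty$. Its Fourier coefficients are $A_\xi(f)=\lim_{T\to\infty}\frac1T\int_0^T f(x)e^{-i\xi x}\,dx$, $\xi\in\mathbb R$, and its Fourier exponents are the $\xi$ with $A_\xi(f)\neq0$. For $1\le p<\infty$ let $\|f\|_p=\big(\sum_{\xi}|A_\xi(f)|^p\big)^{1/p}$, and let $B\mathcal S^p$ be the set of $B$-a.p. functions with $\|f\|_p<\infty$. Fix a sequence $(\lambda_k)_{k\in\mathbb Z}$ of reals with $\lambda_0=0$, $\lambda_{-k}=-\lambda_k$, $0<\lambda_k<\lambda_{k+1}$ for $k>0$, and $\lambda_k\to\infty$ as $k\to\infty$. Let $\mathcal F$ be the set of $f\in B\mathcal S^p$ all of whose Fourier exponents belong to $\{\lambda_k\}_{k\in\mathbb Z}$,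 so that $f$ has the Fourier series $\sum_{k\in\mathbb Z}A_k(f)e^{i\lambda_kx}$, $A_k(f)=A_{\lambda_k}(f)$; let $\mathcal F^+$ be the set of $f\in\mathcal F$ with $|A_k(f)|+|A_{-k}(f)|>0$ for all $k>0$. Let $\Phi$ be the set of continuous nonnegative even functions $\varphi:\mathbb R\to\mathbb R$ with $\varphi(0)=0$ whose zero set has Lebesgue measure $0$. For $f\in\mathcal F$, $n\in\mathbb N=\{1,2,\dots\}$, $\varphi\in\Phi$, $\delta\ge0$ put $$E_{\lambda_n}(f)_p=\inf_g\|f-g\|_p,\qquad \omega_\varphi(f,\delta)_p=\sup_{|h|\le\delta}\Big(\sum_{k\in\mathbb Z}\varphi^p(\lambda_kh)|A_k(f)|^p\Big)^{1/p},$$ the infimum being over all $B$-a.p. functions $g$ whose Fourier exponents lie in $(-\lambda_n,\lambda_n)$. For $\tau>0$ let $V(\tau)$ be the set of bounded nondecreasing functions $v$ on $[0,\tau]$ that are not constant on $[0,\tau]$, and put $$I_{n,\varphi,p}(\tau,v)=\inf_{k\in\mathbb N,\,k\ge n}\int_0^\tau\varphi^p\Big(\frac{\lambda_kt}{\lambda_n}\Big)dv(t),\qquad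 C_{n,\varphi,p}(\tau)=\Big(\inf_{v\in V(\tau)}\frac{v(\tau)-v(0)}{I_{n,\varphi,p}(\tau,v)}\Big)^{1/p}.$$ For $\mathcal G\subseteq\mathcal F$ put $K_{n,\varphi,p}(\tau;\mathcal G)=\sup_{f\in\mathcal G}E_{\lambda_n}(f)_p/\omega_\varphi(f,\tau/\lambda_n)_p$. All these quantities take values in $[0,\infty]$, with $0/0=0\cdot\infty=0$, $a/0=\infty$ for $a>0$, and $a/\infty=0$ for $a<\infty$. Theorem. Let $1\le p<\infty$, $\varphi\in\Phi$, $\tau>0$, $n\in\mathbb N$, and let $(\lambda_k)$ be as above. Then: (i) $E_{\lambda_n}(f)_p\le C_{n,\varphi,p}(\tau)\,\omega_\varphi\big(f,\tau/\lambda_n\big)_p$ for every $f\in\mathcal F$; (ii) there is $v_*\in V(\tau)$ at which the infimum in the definition of $C_{n,\varphi,p}(\tau)$ is attained; (iii) the inequality is sharp: $C_{n,\varphi,p}(\tau)=K_{n,\varphi,p}(\tau;\mathcal F)=K_{n,\varphi,p}(\tau;\mathcal F^+)$. -/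

import Mathlib

open MeasureTheory Filter Set
open scoped ENNReal Topology

noncomputable section

/-! ### Besicovitch almost periodic functions and their Fourier coefficients -/

/-- The set of trigonometric sums `∑ a_j e^{i ξ_j x}` with complex coefficients and real
frequencies. -/
def trigSums : Set (ℝ → ℂ) :=
  {g | ∃ (N : ℕ) (a : Fin N → ℂ) (ξ : Fin N → ℝ),
    g = fun x : ℝ => ∑ j, a j * Complex.exp (Complex.I * (ξ j : ℂ) * (x : ℂ))}

/-- The Besicovitch distance of order one,
`limsup_{T → ∞} (1 / 2T) ∫_{-T}^{T} |f - g|`, with values in `[0, ∞]`. -/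
def besicovitchDist (f g : ℝ → ℂ) : ℝ≥0∞ :=
  limsup (fun T : ℝ =>
    ENNReal.ofReal (1 / (2 * T)) * ∫⁻ x in Icc (-T) T, ‖f x - g x‖ₑ) atTop

/-- Besicovitch almost periodic functions of order one (`B`-a.p. functions). -/
def IsBap (f : ℝ → ℂ) : Prop :=
  LocallyIntegrable f volume ∧
    ∃ s : ℕ → ℝ → ℂ, (∀ N, s N ∈ trigSums) ∧
      Tendsto (fun N => besicovitchDist f (s N)) atTop (𝓝 0)

/-- The mean value `M{f} = lim_{T → ∞} (1/T) ∫_0^T f`. -/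
def meanValue (f : ℝ → ℂ) : ℂ :=
  limUnder atTop (fun T : ℝ => ((1 / T : ℝ) : ℂ) * ∫ x in (0 : ℝ)..T, f x)

/-- The Fourier coefficient `A_ξ(f) = M{f(·) e^{-i ξ ·}}`, for `ξ` real. -/
def fourierCoef (f : ℝ → ℂ) (ξ : ℝ) : ℂ :=
  meanValue (fun x : ℝ => f x * Complex.exp (-(Complex.I * (ξ : ℂ) * (x : ℂ))))

/-- The spectrum of `f`: the set of its Fourier exponents. -/
def apSpectrum (f : ℝ → ℂ) : Set ℝ := {ξ | fourierCoef f ξ ≠ 0}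

/-- The norm `‖f‖_p`: the `ℓ^p` norm of the Fourier coefficients, with values in `[0, ∞]`. The sum
runs over all real `ξ`, only the exponents in the spectrum contribute. -/
def bsNorm (p : ℝ) (f : ℝ → ℂ) : ℝ≥0∞ :=
  (∑' ξ : ℝ, ‖fourierCoef f ξ‖ₑ ^ p) ^ (1 / p)

/-- The Besicovitch-Stepanets space `BS^p`. -/
def BS (p : ℝ) : Set (ℝ → ℂ) := {f | IsBap f ∧ bsNorm p f < ∞}

/-! ### Functions whose Fourier exponents have a single limit point at infinity -/

/-- Symmetric sequences `(λ_k)`, `k ∈ ℤ`, with `λ_0 = 0`, `λ_{-k} = -λ_k`,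
`0 < λ_k < λ_{k+1}` for `k > 0`, and no finite limit point. -/
structure IsExponentSeq (lam : ℤ → ℝ) : Prop where
  zero : lam 0 = 0
  odd : ∀ k, lam (-k) = -lam k
  pos : ∀ k, 0 < k → 0 < lam k
  lt_succ : ∀ k, 0 < k → lam k < lam (k + 1)
  tendsto : Tendsto lam atTop atTop

/-- Functions of `BS^p` with a Fourier series `∑_{k ∈ ℤ} A_k e^{i λ_k x}`, where some of the
coefficients `A_k` are allowed to vanish. -/
def BSOn (p : ℝ) (lam : ℤ → ℝ) : Set (ℝ → ℂ) :=
  {f | f ∈ BS p ∧ apSpectrum f ⊆ range lam}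

/-- Functions of `BS^p` with a Fourier series `∑_{k ∈ ℤ} A_k e^{i λ_k x}`, where
`|A_k| + |A_{-k}| > 0` for all `k > 0`. -/
def BSExact (p : ℝ) (lam : ℤ → ℝ) : Set (ℝ → ℂ) :=
  {f | f ∈ BSOn p lam ∧
    ∀ k : ℤ, 0 < k → 0 < ‖fourierCoef f (lam k)‖ + ‖fourierCoef f (lam (-k))‖}

/-! ### Best approximations and generalized moduli of smoothness -/

/-- `B`-a.p. functions all of whose Fourier exponents lie in `(-r, r)`. -/
def apBand (r : ℝ) : Set (ℝ → ℂ) := {g | IsBap g ∧ apSpectrum g ⊆ Ioo (-r) r}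

/-- The best approximation `E_r(f)_p = inf_{g ∈ G_r} ‖f - g‖_p`. -/
def bestApprox (p r : ℝ) (f : ℝ → ℂ) : ℝ≥0∞ :=
  ⨅ g ∈ apBand r, bsNorm p (fun x => f x - g x)

/-- The class `Φ` of continuous nonnegative even functions vanishing at `0` whose zero set is a
Lebesgue null set. -/
structure IsPhi (φ : ℝ → ℝ) : Prop where
  continuous : Continuous φ
  nonneg : ∀ t, 0 ≤ φ t
  even : ∀ t, φ (-t) = φ t
  zero : φ 0 = 0
  null : volume {t : ℝ | φ t = 0} = 0

/-- The generalized modulus of smoothness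
`ω_φ(f, δ)_p = sup_{|h| ≤ δ} (∑_{k ∈ ℤ} φ(λ_k h)^p |A_k(f)|^p)^{1/p}`, with values in
`[0, ∞]`. -/
def genModulus (p : ℝ) (lam : ℤ → ℝ) (φ : ℝ → ℝ) (f : ℝ → ℂ) (δ : ℝ) : ℝ≥0∞ :=
  ⨆ h ∈ Icc (-δ) δ,
    (∑' k : ℤ, ENNReal.ofReal (φ (lam k * h)) ^ p * ‖fourierCoef f (lam k)‖ₑ ^ p) ^ (1 / p)

/-! ### Weights and the constants -/

/-- The set `V(τ)`: functions that are nondecreasing on `[0, τ]` (hence bounded there) and not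
constant on `[0, τ]`. The values outside `[0, τ]` are irrelevant. -/
structure Weight (τ : ℝ) where
  toFun : ℝ → ℝ
  monotoneOn : MonotoneOn toFun (Icc 0 τ)
  not_const : ¬ ∃ c, ∀ t ∈ Icc 0 τ, toFun t = c

/-- The extension of a weight from `[0, τ]` to `ℝ` by its values at the end points. -/
def Weight.ext {τ : ℝ} (v : Weight τ) (t : ℝ) : ℝ := v.toFun (max 0 (min t τ))

theorem Weight.monotone_ext {τ : ℝ} (v : Weight τ) : Monotone v.ext := by
  have hτ : 0 ≤ τ := by
    by_contra h
    exact v.not_const ⟨0, fun t ht => absurd (ht.1.trans ht.2) h⟩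
  intro s t hst
  exact v.monotoneOn ⟨le_max_left _ _, max_le hτ (min_le_right _ _)⟩
    ⟨le_max_left _ _, max_le hτ (min_le_right _ _)⟩
    (max_le_max le_rfl (min_le_min hst le_rfl))

/-- The measure `dv` on `[0, τ]`. Jumps of `v` at the end points, that is `v(0+) - v(0)` and
`v(τ) - v(τ-)`, are counted as atoms, so that integrals of continuous functions against it are the
Riemann-Stieltjes integrals over `[0, τ]` and its total mass is `v(τ) - v(0)`. -/
def Weight.measure {τ : ℝ} (v : Weight τ) : Measure ℝ :=
  v.monotone_ext.stieltjesFunction.measure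

/-- `I_{n,φ,p}(τ, v) = inf_{k ≥ n} ∫_0^τ φ(λ_k t / λ_n)^p dv(t)`. -/
def jacksonI (p : ℝ) (lam : ℤ → ℝ) (φ : ℝ → ℝ) (n : ℕ) {τ : ℝ} (v : Weight τ) : ℝ≥0∞ :=
  ⨅ (k : ℕ) (_ : n ≤ k),
    ∫⁻ t in Icc 0 τ, ENNReal.ofReal (φ (lam k * t / lam n)) ^ p ∂v.measure

/-- The quotient `(v(τ) - v(0)) / I_{n,φ,p}(τ, v)`; it is `∞` when the denominator vanishes. -/
def jacksonRatio (p : ℝ) (lam : ℤ → ℝ) (φ : ℝ → ℝ) (n : ℕ) {τ : ℝ} (v : Weight τ) : ℝ≥0∞ :=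
  ENNReal.ofReal (v.toFun τ - v.toFun 0) / jacksonI p lam φ n v

/-- `C_{n,φ,p}(τ) = (inf_{v ∈ V(τ)} (v(τ) - v(0)) / I_{n,φ,p}(τ, v))^{1/p}`. -/
def jacksonC (p : ℝ) (lam : ℤ → ℝ) (φ : ℝ → ℝ) (n : ℕ) (τ : ℝ) : ℝ≥0∞ :=
  (⨅ v : Weight τ, jacksonRatio p lam φ n v) ^ (1 / p)

/-- The least constant `K_{n,φ,p}(τ) = sup_f E_{λ_n}(f)_p / ω_φ(f, τ/λ_n)_p` on a class `S` of
functions. In `[0, ∞]` one has `0 / 0 = 0`, and `a / 0 = ∞` for `a > 0`. -/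
def jacksonK (p : ℝ) (lam : ℤ → ℝ) (φ : ℝ → ℝ) (n : ℕ) (τ : ℝ) (S : Set (ℝ → ℂ)) : ℝ≥0∞ :=
  ⨆ f ∈ S, bestApprox p (lam n) f / genModulus p lam φ f (τ / lam n)

end

/-- **Minimax principle**: if every convex combination of a family of continuous functions on a
compact space is at least `s` somewhere, there is a probability measure against which every member
of the family has integral at least `s`. -/
theorem exists_probabilityMeasure_forall_le_integral {X ι : Type*} [TopologicalSpace X]
    [CompactSpace X] [T2Space X] [MeasurableSpace X] [BorelSpace X] [Nonempty ι]
    (ψ : ι → C(X, ℝ)) (s : ℝ)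
    (h : ∀ w : ι →₀ ℝ, (∀ i, 0 ≤ w i) → Finsupp.linearCombination ℝ (fun _ => (1 : ℝ)) w = 1 →
      ∃ x, s ≤ Finsupp.linearCombination ℝ ψ w x) :
    ∃ μ : Measure X, IsProbabilityMeasure μ ∧ ∀ i, s ≤ ∫ x, ψ i x ∂μ := by
  classical
  let A : Set C(X, ℝ) := {g | ∀ x, g x < s}
  let W : Set (ι →₀ ℝ) :=
    {w | (∀ i, 0 ≤ w i) ∧ Finsupp.linearCombination ℝ (fun _ => (1 : ℝ)) w = 1}
  have hA : Convex ℝ A := by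
    intro f hf g hg a b ha hb hab x
    have h1 := hf x
    have h2 := hg x
    simp only [ContinuousMap.add_apply, ContinuousMap.smul_apply, smul_eq_mul]
    exact (convex_Iio s) h1 h2 ha hb hab
  have hAo : IsOpen A := by
    have h1 := ContinuousMap.isOpen_setOfPred_mapsTo (X := X) (Y := ℝ) isCompact_univ
      (isOpen_Iio (a := s))
    have h2 : A = {f : C(X, ℝ) | MapsTo f univ (Iio s)} := by
      ext f; simp [A, MapsTo]
    rw [h2]; exact h1
  have hW : Convex ℝ W := by
    intro f hf g hg a b ha hb hab
    refine ⟨fun i => ?_, ?_⟩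
    · simpa using add_nonneg (mul_nonneg ha (hf.1 i)) (mul_nonneg hb (hg.1 i))
    · rw [map_add, map_smul, map_smul, hf.2, hg.2]; simpa using hab
  have hB := hW.linear_image (Finsupp.linearCombination ℝ ψ)
  have hd : Disjoint A (Finsupp.linearCombination ℝ ψ '' W) := by
    rw [Set.disjoint_left]
    rintro _ hg ⟨w, hw, rfl⟩
    obtain ⟨x, hx⟩ := h w hw.1 hw.2
    exact absurd (hg x) (not_lt.2 hx)
  obtain ⟨L, u, hL, hu⟩ := geometric_hahn_banach_open hA hAo hB hd
  have hψ : ∀ i, u ≤ L (ψ i) := fun i => hu _ ⟨Finsupp.single i 1, ⟨fun j => by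
    rw [Finsupp.single_apply]; split_ifs <;> simp, by simp⟩, by simp⟩
  have hLpos : ∀ f : C(X, ℝ), 0 ≤ f → 0 ≤ L f := by
    intro f hf
    by_contra! hneg
    set c := L (ContinuousMap.const X (s - 1)) with hc
    have key : ∀ t : ℝ, 0 ≤ t → c - t * L f < u := by
      intro t ht
      have := hL (ContinuousMap.const X (s - 1) - t • f) (fun x => by
        have : 0 ≤ t * f x := mul_nonneg ht (hf x)
        simp only [ContinuousMap.sub_apply, ContinuousMap.const_apply, ContinuousMap.smul_apply,
          smul_eq_mul]
        linarith)
      simpa [hc] using this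
    have h1 := key ((|u - c|) / (- L f)) (div_nonneg (abs_nonneg _) (by linarith))
    have h2 : (|u - c|) / (- L f) * L f = -|u - c| := by
      rw [div_neg, neg_mul, div_mul_cancel₀ _ hneg.ne]
    rw [h2] at h1
    have := le_abs_self (u - c)
    linarith
  have hLmono : ∀ f g : C(X, ℝ), f ≤ g → L f ≤ L g := fun f g hfg => by
    have := hLpos (g - f) (sub_nonneg.2 hfg)
    rw [map_sub] at this; linarith
  have hone : 0 < L 1 := by
    refine lt_of_le_of_ne (hLpos 1 (fun x => zero_le_one)) fun h0 => ?_
    have hz : ∀ f, L f = 0 := by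
      intro f
      have h1 := hLmono f (‖f‖ • 1) (fun x => by
        simpa using (le_abs_self _).trans (f.norm_coe_le_norm x))
      have h2 := hLmono (-(‖f‖ • 1)) f (fun x => by
        simpa using (abs_le.1 (f.norm_coe_le_norm x)).1)
      rw [map_neg, map_smul, ← h0] at h2
      rw [map_smul, ← h0] at h1
      simp at h1 h2
      linarith
    have h1 := hL (ContinuousMap.const X (s - 1)) (fun x => by simp)
    have h2 := hψ (Classical.arbitrary ι)
    rw [hz] at h1 h2
    linarith
  have hsu : s * L 1 ≤ u := by
    refine le_of_forall_lt_imp_le_of_dense fun r hr => ?_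
    have hr' : r / L 1 < s := by rwa [div_lt_iff₀ hone]
    have := hL ((r / L 1) • (1 : C(X, ℝ))) (fun x => by simpa using hr')
    rw [map_smul, smul_eq_mul, div_mul_cancel₀ _ hone.ne'] at this
    exact this.le
  let Λ : CompactlySupportedContinuousMap X ℝ →ₚ[ℝ] ℝ := PositiveLinearMap.mk₀
    { toFun := fun f => (L 1)⁻¹ * L f.toContinuousMap
      map_add' := fun f g => by
        rw [← mul_add, ← map_add]; rfl
      map_smul' := fun a f => by
        have : (a • f).toContinuousMap = a • f.toContinuousMap := rfl
        rw [this, map_smul]; simp only [smul_eq_mul, RingHom.id_apply]; ring }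
    (fun f hf => mul_nonneg (inv_nonneg.2 hone.le) (hLpos _ hf))
  have hΛ : ∀ f : C(X, ℝ), ∫ x, f x ∂(RealRMK.rieszMeasure Λ) = (L 1)⁻¹ * L f := fun f =>
    RealRMK.integral_rieszMeasure Λ (CompactlySupportedContinuousMap.continuousMapEquiv f)
  refine ⟨RealRMK.rieszMeasure Λ, ⟨?_⟩, fun i => ?_⟩
  · have := hΛ 1
    simp only [ContinuousMap.one_apply, integral_const, smul_eq_mul, mul_one,
      inv_mul_cancel₀ hone.ne', Measure.real] at this
    rwa [ENNReal.toReal_eq_one_iff] at this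
  · rw [hΛ, le_inv_mul_iff₀ hone, mul_comm]
    exact hsu.trans (hψ i)

/-- A probability measure on `[0, τ]` is the measure of a weight of total increment one. -/
theorem exists_weight_of_measure {τ : ℝ} (hτ : 0 < τ) (μ : Measure ℝ) [IsProbabilityMeasure μ]
    (hμ : μ (Icc 0 τ)ᶜ = 0) :
    ∃ v : Weight τ, v.measure = μ ∧ v.toFun τ - v.toFun 0 = 1 := by
  have hneg : ∀ t < 0, ProbabilityTheory.cdf μ t = 0 := fun t ht => by
    rw [ProbabilityTheory.cdf_eq_real, measureReal_eq_zero_iff]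
    exact measure_mono_null (t := (Icc 0 τ)ᶜ) (fun x hx hx' => (hx'.1.trans hx).not_gt ht) hμ
  have hbig : ∀ t, τ ≤ t → ProbabilityTheory.cdf μ t = 1 := fun t ht => by
    rw [ProbabilityTheory.cdf_eq_real, Measure.real, ENNReal.toReal_eq_one_iff,
      prob_compl_eq_zero_iff measurableSet_Iic |>.1]
    exact measure_mono_null (t := (Icc 0 τ)ᶜ) (fun x hx hx' => hx (hx'.2.trans ht)) hμ
  let v : Weight τ :=
    { toFun := fun t => if t ≤ 0 then 0 else ProbabilityTheory.cdf μ t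
      monotoneOn := fun a ha b hb hab => by
        dsimp only
        split_ifs with h1 h2 h2
        · exact le_rfl
        · exact ProbabilityTheory.cdf_nonneg μ b
        · exact absurd (hab.trans h2) h1
        · exact ProbabilityTheory.monotone_cdf μ hab
      not_const := by
        rintro ⟨c, hc⟩
        have h1 := hc 0 ⟨le_rfl, hτ.le⟩
        have h2 := hc τ ⟨hτ.le, le_rfl⟩
        simp only [le_refl, if_true, hτ.not_ge, if_false, hbig τ le_rfl] at h1 h2
        linarith }
  have hv : ∀ t, t ≠ 0 → v.ext t = ProbabilityTheory.cdf μ t := by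
    intro t ht
    simp only [Weight.ext, v]
    rcases lt_or_gt_of_ne ht with h | h
    · rw [if_pos (by simp [h.le]), hneg t h]
    · rw [if_neg (by simp [h, hτ])]
      rcases le_total t τ with h' | h'
      · rw [min_eq_left h', max_eq_right h.le]
      · rw [min_eq_right h', max_eq_right hτ.le, hbig _ le_rfl, hbig _ h']
  refine ⟨v, ?_, ?_⟩
  · have : v.monotone_ext.stieltjesFunction = ProbabilityTheory.cdf μ := by
      ext t
      rw [Monotone.stieltjesFunction_eq]
      refine (tendsto_nhds_unique (v.monotone_ext.tendsto_rightLim t) ?_)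
      have h1 : Tendsto (ProbabilityTheory.cdf μ) (𝓝[>] t) (𝓝 (ProbabilityTheory.cdf μ t)) :=
        ((ProbabilityTheory.cdf μ).right_continuous t).mono Ioi_subset_Ici_self
      refine h1.congr' ?_
      rcases lt_or_ge t 0 with h | h
      · filter_upwards [nhdsWithin_le_nhds (Iio_mem_nhds h)] with x hx
        exact (hv x (ne_of_lt hx)).symm
      · filter_upwards [self_mem_nhdsWithin] with x hx
        exact (hv x (ne_of_gt (lt_of_le_of_lt h hx))).symm
    rw [Weight.measure, this, ProbabilityTheory.measure_cdf]
  · simp [v, hτ.not_ge, hbig τ le_rfl]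

theorem Weight.nonneg {τ : ℝ} (v : Weight τ) : 0 ≤ τ := by
  by_contra h
  exact v.not_const ⟨0, fun t ht => absurd (ht.1.trans ht.2) h⟩

theorem Weight.lt {τ : ℝ} (v : Weight τ) : v.toFun 0 < v.toFun τ := by
  have hτ := v.nonneg
  by_contra! h
  refine v.not_const ⟨v.toFun 0, fun t ht => le_antisymm ?_ ?_⟩
  · exact (v.monotoneOn ht ⟨hτ, le_rfl⟩ ht.2).trans h
  · exact v.monotoneOn ⟨le_rfl, hτ⟩ ht ht.1

theorem Weight.measure_Icc_le {τ : ℝ} (v : Weight τ) :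
    v.measure (Icc 0 τ) ≤ ENNReal.ofReal (v.toFun τ - v.toFun 0) := by
  have hτ := v.nonneg
  refine (measure_mono (t := Ioc (-1) τ) fun x hx => ⟨by linarith [hx.1], hx.2⟩).trans ?_
  rw [Weight.measure, StieltjesFunction.measure_Ioc]
  refine ENNReal.ofReal_le_ofReal (sub_le_sub ?_ ?_)
  · rw [Monotone.stieltjesFunction_eq]
    refine (v.monotone_ext.rightLim_le (lt_add_one τ)).trans (le_of_eq ?_)
    simp [Weight.ext, hτ]
  · rw [Monotone.stieltjesFunction_eq]
    refine le_trans (le_of_eq ?_) (v.monotone_ext.le_rightLim le_rfl)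
    simp [Weight.ext]

/-! ### Mean values -/

/-- The mean value of `f` exists and equals `m`. -/
def HasMeanValue (f : ℝ → ℂ) (m : ℂ) : Prop :=
  Tendsto (fun T : ℝ => ((1 / T : ℝ) : ℂ) * ∫ x in (0 : ℝ)..T, f x) atTop (𝓝 m)

theorem HasMeanValue.meanValue_eq {f : ℝ → ℂ} {m : ℂ} (h : HasMeanValue f m) : meanValue f = m :=
  Tendsto.limUnder_eq h

theorem MeasureTheory.LocallyIntegrable.intervalIntegrable' {f : ℝ → ℂ}
    (hf : LocallyIntegrable f volume) (a b : ℝ) : IntervalIntegrable f volume a b :=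
  (hf.integrableOn_isCompact isCompact_uIcc).intervalIntegrable

theorem HasMeanValue.sub {f g : ℝ → ℂ} {m k : ℂ} (hf : LocallyIntegrable f volume)
    (hg : LocallyIntegrable g volume) (h : HasMeanValue f m) (h' : HasMeanValue g k) :
    HasMeanValue (fun x => f x - g x) (m - k) := by
  refine (Tendsto.sub h h').congr fun T => ?_
  rw [intervalIntegral.integral_sub (hf.intervalIntegrable' 0 T) (hg.intervalIntegrable' 0 T),
    mul_sub]

theorem HasMeanValue.finset_sum {ι : Type*} (s : Finset ι) {f : ι → ℝ → ℂ} {m : ι → ℂ}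
    (hf : ∀ i ∈ s, LocallyIntegrable (f i) volume) (h : ∀ i ∈ s, HasMeanValue (f i) (m i)) :
    HasMeanValue (fun x => ∑ i ∈ s, f i x) (∑ i ∈ s, m i) := by
  refine (tendsto_finsetSum s h).congr fun T => ?_
  rw [intervalIntegral.integral_finsetSum fun i hi => (hf i hi).intervalIntegrable' 0 T,
    Finset.mul_sum]

theorem HasMeanValue.const_mul {f : ℝ → ℂ} {m : ℂ} (c : ℂ) (h : HasMeanValue f m) :
    HasMeanValue (fun x => c * f x) (c * m) := by
  refine (Tendsto.const_mul c h).congr fun T => ?_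
  rw [intervalIntegral.integral_const_mul]; ring

theorem hasMeanValue_exp (ξ : ℝ) :
    HasMeanValue (fun x : ℝ => Complex.exp (Complex.I * ξ * x)) (if ξ = 0 then 1 else 0) := by
  split_ifs with h
  · subst h
    refine tendsto_const_nhds.congr' ?_
    filter_upwards [eventually_gt_atTop 0] with T hT
    have : (T : ℂ) ≠ 0 := by exact_mod_cast hT.ne'
    simp [this]
  · have hc : Complex.I * (ξ : ℂ) ≠ 0 := by simp [h]
    refine squeeze_zero_norm' (a := fun T : ℝ => 1 / T * (2 / |ξ|)) ?_ ?_
    · filter_upwards [eventually_gt_atTop 0] with T hT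
      rw [integral_exp_mul_complex hc, norm_mul, norm_div]
      have h1 : ‖((1 / T : ℝ) : ℂ)‖ = 1 / T := by
        rw [Complex.norm_real, Real.norm_of_nonneg (by positivity)]
      have h2 : ‖Complex.I * (ξ : ℂ)‖ = |ξ| := by simp
      rw [h1, h2]
      gcongr
      refine (norm_sub_le _ _).trans (le_of_eq ?_)
      have h3 : ∀ y : ℝ, ‖Complex.exp (Complex.I * ξ * y)‖ = 1 := fun y => by
        rw [mul_assoc, mul_comm, ← Complex.ofReal_mul, Complex.norm_exp_ofReal_mul_I]
      rw [h3, h3]; norm_num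
    · have := (tendsto_inv_atTop_zero (𝕜 := ℝ)).mul_const (2 / |ξ|)
      simpa using this

/-! ### The Besicovitch distance -/

theorem eventually_norm_average_sub_le {f g : ℝ → ℂ} (hf : LocallyIntegrable f volume)
    (hg : LocallyIntegrable g volume) {ε : ℝ} (hε : 0 ≤ ε)
    (h : besicovitchDist f g < ENNReal.ofReal ε) :
    ∀ᶠ T : ℝ in atTop, ‖((1 / T : ℝ) : ℂ) * (∫ x in (0 : ℝ)..T, f x) -
      ((1 / T : ℝ) : ℂ) * ∫ x in (0 : ℝ)..T, g x‖ ≤ 2 * ε := by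
  filter_upwards [eventually_lt_of_limsup_lt h, eventually_gt_atTop 0] with T hT hT0
  rw [← mul_sub, ← intervalIntegral.integral_sub (hf.intervalIntegrable' 0 T)
    (hg.intervalIntegrable' 0 T), intervalIntegral.integral_of_le hT0.le]
  rw [← ENNReal.ofReal_le_ofReal_iff (by positivity), ofReal_norm, enorm_mul]
  have h1 : ‖((1 / T : ℝ) : ℂ)‖ₑ = ENNReal.ofReal 2 * ENNReal.ofReal (1 / (2 * T)) := by
    rw [← ofReal_norm, Complex.norm_real, Real.norm_of_nonneg (by positivity),
      ← ENNReal.ofReal_mul (by norm_num)]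
    congr 1; field_simp
  rw [h1, mul_assoc, ENNReal.ofReal_mul (by norm_num)]
  gcongr
  refine le_trans ?_ hT.le
  gcongr
  refine (enorm_integral_le_lintegral_enorm _).trans ?_
  exact lintegral_mono_set fun x hx => ⟨by linarith [hx.1], hx.2⟩

theorem besicovitchDist_le_of_norm_sub_le {f g : ℝ → ℂ} {r : ℝ} (h : ∀ x, ‖f x - g x‖ ≤ r) :
    besicovitchDist f g ≤ ENNReal.ofReal r := by
  refine limsup_le_of_le (by isBoundedDefault) ?_
  filter_upwards [eventually_gt_atTop 0] with T hT
  calc _ ≤ ENNReal.ofReal (1 / (2 * T)) * ∫⁻ x in Icc (-T) T, ENNReal.ofReal r := by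
        gcongr with x
        rw [← ofReal_norm]
        exact ENNReal.ofReal_le_ofReal (h x)
    _ = ENNReal.ofReal r := by
        rw [setLIntegral_const, Real.volume_Icc, mul_comm, mul_assoc,
          ← ENNReal.ofReal_mul (by linarith)]
        have : (T - -T) * (1 / (2 * T)) = 1 := by field_simp; ring
        rw [this]; simp

theorem besicovitchDist_self (f : ℝ → ℂ) : besicovitchDist f f = 0 := by
  simpa using besicovitchDist_le_of_norm_sub_le (f := f) (g := f) (r := 0) (by simp)

theorem besicovitchDist_mul_of_norm_eq_one {f g e : ℝ → ℂ} (he : ∀ x, ‖e x‖ = 1) :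
    besicovitchDist (fun x => f x * e x) (fun x => g x * e x) = besicovitchDist f g := by
  simp only [besicovitchDist, ← sub_mul, enorm_mul]
  have : ∀ x, ‖e x‖ₑ = 1 := fun x => by rw [← ofReal_norm, he]; simp
  simp [this]

/-- The mean value passes to limits in the Besicovitch distance. -/
theorem exists_hasMeanValue_of_tendsto {f : ℝ → ℂ} {s : ℕ → ℝ → ℂ} {m : ℕ → ℂ}
    (hf : LocallyIntegrable f volume) (hs : ∀ N, LocallyIntegrable (s N) volume)
    (hm : ∀ N, HasMeanValue (s N) (m N))
    (h : Tendsto (fun N => besicovitchDist f (s N)) atTop (𝓝 0)) :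
    ∃ a, HasMeanValue f a ∧ Tendsto m atTop (𝓝 a) := by
  have hsmall : ∀ ε : ℝ, 0 < ε → ∀ᶠ N in atTop, besicovitchDist f (s N) < ENNReal.ofReal ε :=
    fun ε hε => h.eventually_lt_const (ENNReal.ofReal_pos.2 hε)
  have hex : ∃ a, HasMeanValue f a := by
    refine cauchy_map_iff_exists_tendsto.1 (Metric.cauchy_iff.2 ⟨inferInstance, fun ε hε => ?_⟩)
    obtain ⟨N, hN⟩ := (hsmall (ε / 8) (by positivity)).exists
    refine ⟨Metric.ball (m N) (ε / 2), ?_, fun x hx y hy => ?_⟩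
    · rw [mem_map]
      filter_upwards [eventually_norm_average_sub_le hf (hs N) (by positivity) hN,
        (hm N).eventually (Metric.ball_mem_nhds _ (show 0 < ε / 4 by positivity))] with T h1 h2
      rw [mem_preimage, Metric.mem_ball]
      rw [← dist_eq_norm] at h1
      refine (dist_triangle _ _ _).trans_lt ((add_lt_add_of_le_of_lt h1 h2).trans_eq ?_)
      ring
    · rw [Metric.mem_ball] at hx hy
      exact (dist_triangle_right x y (m N)).trans_lt (by linarith)
  obtain ⟨a, ha⟩ := hex
  refine ⟨a, ha, Metric.tendsto_nhds.2 fun ε hε => ?_⟩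
  filter_upwards [hsmall (ε / 4) (by positivity)] with N hN
  have h1 := le_of_tendsto (Tendsto.sub ha (hm N)).norm
    (eventually_norm_average_sub_le hf (hs N) (by positivity) hN)
  rw [dist_comm, dist_eq_norm]
  linarith

/-! ### Fourier coefficients -/

theorem norm_exp_neg_I_mul (ξ x : ℝ) : ‖Complex.exp (-(Complex.I * (ξ : ℂ) * (x : ℂ)))‖ = 1 := by
  have : -(Complex.I * (ξ : ℂ) * (x : ℂ)) = ((-(ξ * x) : ℝ) : ℂ) * Complex.I := by
    push_cast; ring
  rw [this, Complex.norm_exp_ofReal_mul_I]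

theorem norm_exp_I_mul (ξ x : ℝ) : ‖Complex.exp (Complex.I * (ξ : ℂ) * (x : ℂ))‖ = 1 := by
  have : Complex.I * (ξ : ℂ) * (x : ℂ) = ((ξ * x : ℝ) : ℂ) * Complex.I := by
    push_cast; ring
  rw [this, Complex.norm_exp_ofReal_mul_I]

theorem MeasureTheory.LocallyIntegrable.mul_exp {f : ℝ → ℂ} (hf : LocallyIntegrable f volume)
    (ξ : ℝ) : LocallyIntegrable
      (fun x : ℝ => f x * Complex.exp (-(Complex.I * (ξ : ℂ) * (x : ℂ)))) volume := by
  rw [locallyIntegrable_iff] at hf ⊢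
  intro k hk
  exact (hf k hk).mul_continuousOn (by fun_prop) hk

theorem hasMeanValue_trigSum {ι : Type*} (s : Finset ι) (a : ι → ℂ) (ν : ι → ℝ) (ξ : ℝ) :
    HasMeanValue (fun x : ℝ => (∑ j ∈ s, a j * Complex.exp (Complex.I * (ν j : ℂ) * (x : ℂ))) *
      Complex.exp (-(Complex.I * (ξ : ℂ) * (x : ℂ)))) (∑ j ∈ s, if ν j = ξ then a j else 0) := by
  have h := HasMeanValue.finset_sum s
    (f := fun j (x : ℝ) => a j * Complex.exp (Complex.I * ((ν j - ξ : ℝ) : ℂ) * x))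
    (m := fun j => a j * if ν j - ξ = 0 then 1 else 0)
    (fun j _ => Continuous.locallyIntegrable (by fun_prop))
    (fun j _ => (hasMeanValue_exp (ν j - ξ)).const_mul (a j))
  have h1 : (∑ j ∈ s, if ν j = ξ then a j else 0) =
      ∑ j ∈ s, a j * if ν j - ξ = 0 then 1 else 0 := by
    refine Finset.sum_congr rfl fun j _ => ?_
    simp [sub_eq_zero]
  rw [h1]
  convert h using 2 with x
  rw [Finset.sum_mul]
  refine Finset.sum_congr rfl fun j _ => ?_
  rw [mul_assoc, ← Complex.exp_add]
  congr 2
  push_cast; ring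

theorem mem_trigSums_finset {ι : Type*} (s : Finset ι) (a : ι → ℂ) (ν : ι → ℝ) :
    (fun x : ℝ => ∑ j ∈ s, a j * Complex.exp (Complex.I * (ν j : ℂ) * (x : ℂ))) ∈ trigSums := by
  refine ⟨s.card, fun i => a (s.equivFin.symm i), fun i => ν (s.equivFin.symm i), ?_⟩
  ext x
  rw [← Finset.sum_coe_sort]
  exact (Equiv.sum_comp s.equivFin.symm
    (fun j : s => a j * Complex.exp (Complex.I * (ν j : ℂ) * (x : ℂ)))).symm

theorem continuous_of_mem_trigSums {g : ℝ → ℂ} (hg : g ∈ trigSums) : Continuous g := by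
  obtain ⟨N, a, ξ, rfl⟩ := hg
  fun_prop

theorem isBap_of_mem_trigSums {g : ℝ → ℂ} (hg : g ∈ trigSums) : IsBap g :=
  ⟨(continuous_of_mem_trigSums hg).locallyIntegrable, fun _ => g, fun _ => hg, by
    simp [besicovitchDist_self]⟩

theorem fourierCoef_trigSum {ι : Type*} (s : Finset ι) (a : ι → ℂ) (ν : ι → ℝ) (ξ : ℝ) :
    fourierCoef (fun x : ℝ => ∑ j ∈ s, a j * Complex.exp (Complex.I * (ν j : ℂ) * (x : ℂ))) ξ =
      ∑ j ∈ s, if ν j = ξ then a j else 0 :=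
  (hasMeanValue_trigSum s a ν ξ).meanValue_eq

theorem tendsto_besicovitchDist_mul_exp {f : ℝ → ℂ} {s : ℕ → ℝ → ℂ}
    (h : Tendsto (fun N => besicovitchDist f (s N)) atTop (𝓝 0)) (ξ : ℝ) :
    Tendsto (fun N => besicovitchDist
      (fun x : ℝ => f x * Complex.exp (-(Complex.I * (ξ : ℂ) * (x : ℂ))))
      (fun x : ℝ => s N x * Complex.exp (-(Complex.I * (ξ : ℂ) * (x : ℂ))))) atTop (𝓝 0) := by
  simpa only [besicovitchDist_mul_of_norm_eq_one (norm_exp_neg_I_mul ξ)] using h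

theorem IsBap.hasMeanValue {f : ℝ → ℂ} (hf : IsBap f) (ξ : ℝ) :
    HasMeanValue (fun x : ℝ => f x * Complex.exp (-(Complex.I * (ξ : ℂ) * (x : ℂ))))
      (fourierCoef f ξ) := by
  obtain ⟨hloc, s, hs, hlim⟩ := hf
  have hm : ∀ N, ∃ m, HasMeanValue
      (fun x : ℝ => s N x * Complex.exp (-(Complex.I * (ξ : ℂ) * (x : ℂ)))) m := fun N => by
    obtain ⟨n, a, ν, h⟩ := hs N
    rw [h]
    exact ⟨_, hasMeanValue_trigSum Finset.univ a ν ξ⟩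
  choose m hm using hm
  obtain ⟨a, ha, -⟩ := exists_hasMeanValue_of_tendsto (hloc.mul_exp ξ)
    (fun N => (continuous_of_mem_trigSums (hs N)).locallyIntegrable.mul_exp ξ) hm
    (tendsto_besicovitchDist_mul_exp hlim ξ)
  rwa [fourierCoef, ha.meanValue_eq]

theorem IsBap.fourierCoef_sub {f g : ℝ → ℂ} (hf : IsBap f) (hg : IsBap g) (ξ : ℝ) :
    fourierCoef (fun x => f x - g x) ξ = fourierCoef f ξ - fourierCoef g ξ := by
  have := HasMeanValue.sub (hf.1.mul_exp ξ) (hg.1.mul_exp ξ) (hf.hasMeanValue ξ) (hg.hasMeanValue ξ)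
  simp only [← sub_mul] at this
  exact this.meanValue_eq

/-- Absolutely convergent trigonometric series are almost periodic, with the expected Fourier
coefficients. -/
theorem isBap_tsum {c : ℕ → ℂ} (hc : Summable fun k => ‖c k‖) (ν : ℕ → ℝ) :
    IsBap (fun x : ℝ => ∑' k, c k * Complex.exp (Complex.I * (ν k : ℂ) * (x : ℂ))) ∧
    ∀ ξ, HasSum (fun k => if ν k = ξ then c k else 0) (fourierCoef
      (fun x : ℝ => ∑' k, c k * Complex.exp (Complex.I * (ν k : ℂ) * (x : ℂ))) ξ) := by
  set f := fun x : ℝ => ∑' k, c k * Complex.exp (Complex.I * (ν k : ℂ) * (x : ℂ)) with hfdef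
  have hn : ∀ k (x : ℝ), ‖c k * Complex.exp (Complex.I * (ν k : ℂ) * (x : ℂ))‖ ≤ ‖c k‖ :=
    fun k x => by rw [norm_mul, norm_exp_I_mul, mul_one]
  have hcont : Continuous f := continuous_tsum (fun k => by fun_prop) hc hn
  let s : ℕ → ℝ → ℂ := fun N x =>
    ∑ k ∈ Finset.range N, c k * Complex.exp (Complex.I * (ν k : ℂ) * (x : ℂ))
  have hs : ∀ N, s N ∈ trigSums := fun N => mem_trigSums_finset _ c ν
  have hlim : Tendsto (fun N => besicovitchDist f (s N)) atTop (𝓝 0) := by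
    refine tendsto_of_tendsto_of_tendsto_of_le_of_le tendsto_const_nhds
      (h := fun N => ENNReal.ofReal (∑' k, ‖c (k + N)‖)) ?_ (fun _ => zero_le) fun N => ?_
    · have := ENNReal.tendsto_ofReal (tendsto_sum_nat_add fun k => ‖c k‖)
      simpa using this
    · refine besicovitchDist_le_of_norm_sub_le fun x => ?_
      have hsum : Summable fun k => c k * Complex.exp (Complex.I * (ν k : ℂ) * (x : ℂ)) :=
        Summable.of_norm_bounded hc (hn · x)
      have h1 : f x - s N x =
          ∑' k, c (k + N) * Complex.exp (Complex.I * (ν (k + N) : ℂ) * (x : ℂ)) := by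
        rw [sub_eq_iff_eq_add', hfdef]
        exact (hsum.sum_add_tsum_nat_add N).symm
      rw [h1]
      exact tsum_of_norm_bounded ((summable_nat_add_iff N).2 hc).hasSum fun k => hn _ x
  have hbap : IsBap f := ⟨hcont.locallyIntegrable, s, hs, hlim⟩
  refine ⟨hbap, fun ξ => ?_⟩
  have hsum : Summable fun k => if ν k = ξ then c k else 0 :=
    Summable.of_norm_bounded hc fun k => by split_ifs <;> simp
  obtain ⟨a, ha, hma⟩ := exists_hasMeanValue_of_tendsto (hbap.1.mul_exp ξ)
    (fun N => (continuous_of_mem_trigSums (hs N)).locallyIntegrable.mul_exp ξ)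
    (fun N => hasMeanValue_trigSum (Finset.range N) c ν ξ)
    (tendsto_besicovitchDist_mul_exp hlim ξ)
  rw [fourierCoef, ha.meanValue_eq, ← tendsto_nhds_unique hsum.hasSum.tendsto_sum_nat hma]
  exact hsum.hasSum

/-! ### Exponent sequences -/

namespace IsExponentSeq

variable {lam : ℤ → ℝ}

theorem strictMono (h : IsExponentSeq lam) : StrictMono lam := by
  refine strictMono_int_of_lt_succ fun k => ?_
  rcases lt_trichotomy k 0 with hk | rfl | hk
  · have h1 : lam (-(k + 1)) < lam (-k) := by
      rcases eq_or_lt_of_le (show k + 1 ≤ 0 by omega) with h0 | h0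
      · rw [h0, neg_zero, h.zero]; exact h.pos _ (by omega)
      · have := h.lt_succ (-(k + 1)) (by omega)
        rwa [show -(k + 1) + 1 = -k by ring] at this
    rw [h.odd, h.odd] at h1
    linarith
  · rw [h.zero]; exact h.pos _ (by norm_num)
  · exact h.lt_succ k hk

theorem mem_Ioo_iff (h : IsExponentSeq lam) (n : ℕ) (k : ℤ) :
    lam k ∈ Ioo (-lam n) (lam n) ↔ k.natAbs < n := by
  rw [← h.odd, mem_Ioo, h.strictMono.lt_iff_lt, h.strictMono.lt_iff_lt]
  omega

theorem natCast_pos (h : IsExponentSeq lam) {n : ℕ} (hn : 1 ≤ n) : 0 < lam n :=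
  h.pos n (by omega)

theorem apply_natAbs (h : IsExponentSeq lam) (k : ℤ) :
    lam k.natAbs = lam k ∨ lam k.natAbs = -lam k := by
  rcases Int.natAbs_eq k with hk | hk
  · left; rw [← hk]
  · right; rw [← h.odd]; congr 1; omega

end IsExponentSeq

/-! ### Best approximations -/

theorem tail_rpow_le_bestApprox {p : ℝ} (hp : 0 < p) {lam : ℤ → ℝ}
    (hlam : IsExponentSeq lam) (n : ℕ) {f : ℝ → ℂ} (hf : IsBap f) :
    (∑' k : ℤ, if n ≤ k.natAbs then ‖fourierCoef f (lam k)‖ₑ ^ p else 0) ^ (1 / p) ≤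
      bestApprox p (lam n) f := by
  refine le_iInf₂ fun g hg => ENNReal.rpow_le_rpow ?_ (by positivity)
  refine le_trans (ENNReal.tsum_le_tsum fun k => ?_)
    (ENNReal.tsum_comp_le_tsum_of_injective hlam.strictMono.injective _)
  split_ifs with hk
  · have h0 : fourierCoef g (lam k) = 0 := by
      by_contra hne
      have := (hlam.mem_Ioo_iff n k).1 (hg.2 hne)
      omega
    rw [hf.fourierCoef_sub hg.1, h0, sub_zero]
  · exact zero_le

/-- The best approximation is attained at the partial sum of the Fourier series. -/
theorem bestApprox_eq {p : ℝ} (hp : 0 < p) {lam : ℤ → ℝ}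
    (hlam : IsExponentSeq lam) (n : ℕ) {f : ℝ → ℂ} (hf : f ∈ BSOn p lam) :
    bestApprox p (lam n) f =
      (∑' k : ℤ, if n ≤ k.natAbs then ‖fourierCoef f (lam k)‖ₑ ^ p else 0) ^ (1 / p) := by
  refine le_antisymm ?_ (tail_rpow_le_bestApprox hp hlam n hf.1.1)
  let s : Finset ℤ := Finset.Ioo (-(n : ℤ)) n
  let g : ℝ → ℂ := fun x => ∑ k ∈ s,
    fourierCoef f (lam k) * Complex.exp (Complex.I * (lam k : ℂ) * (x : ℂ))
  have hg : IsBap g := isBap_of_mem_trigSums (mem_trigSums_finset s _ lam)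
  have hgc : ∀ ξ, fourierCoef g ξ = ∑ k ∈ s, if lam k = ξ then fourierCoef f (lam k) else 0 :=
    fourierCoef_trigSum s _ lam
  have hgk : ∀ k, fourierCoef g (lam k) = if k.natAbs < n then fourierCoef f (lam k) else 0 := by
    intro k
    rw [hgc]
    simp only [hlam.strictMono.injective.eq_iff, Finset.sum_ite_eq', s, Finset.mem_Ioo]
    refine if_congr ?_ rfl rfl
    omega
  have hgo : ∀ ξ, ξ ∉ range lam → fourierCoef g ξ = 0 := fun ξ hξ => by
    rw [hgc]
    exact Finset.sum_eq_zero fun k _ => if_neg fun h => hξ ⟨k, h⟩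
  have hband : g ∈ apBand (lam n) := by
    refine ⟨hg, fun ξ hξ => ?_⟩
    by_cases h : ξ ∈ range lam
    · obtain ⟨k, rfl⟩ := h
      rw [hlam.mem_Ioo_iff]
      by_contra hk
      exact hξ (by rw [hgk, if_neg hk])
    · exact absurd (hgo ξ h) hξ
  refine (iInf₂_le g hband).trans (ENNReal.rpow_le_rpow (le_of_eq ?_) (by positivity))
  rw [← hlam.strictMono.injective.tsum_eq]
  · refine tsum_congr fun k => ?_
    rw [hf.1.1.fourierCoef_sub hg, hgk]
    by_cases hk : n ≤ k.natAbs
    · rw [if_pos hk, if_neg (by omega), sub_zero]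
    · rw [if_neg hk, if_pos (by omega), sub_self, enorm_zero, ENNReal.zero_rpow_of_pos hp]
  · intro ξ hξ
    by_contra h
    have h0 : fourierCoef f ξ = 0 := by
      by_contra hne
      exact h (hf.2 hne)
    refine hξ ?_
    dsimp only
    rw [hf.1.1.fourierCoef_sub hg, hgo ξ h, h0, sub_self, enorm_zero, ENNReal.zero_rpow_of_pos hp]

/-! ### The direct inequality -/

namespace IsPhi

variable {φ : ℝ → ℝ}

theorem abs_eq (hφ : IsPhi φ) {x y : ℝ} (h : x = y ∨ x = -y) : φ x = φ y := by
  rcases h with rfl | rfl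
  · rfl
  · exact hφ.even y

theorem measurable_rpow (hφ : IsPhi φ) (p a : ℝ) :
    Measurable fun t : ℝ => ENNReal.ofReal (φ (a * t)) ^ p :=
  ((hφ.continuous.comp (continuous_const_mul a)).measurable.ennreal_ofReal).pow_const p

theorem exists_bound (hφ : IsPhi φ) (a τ : ℝ) :
    ∃ M : ℝ, 1 ≤ M ∧ ∀ t ∈ Icc 0 τ, φ (a * t) ≤ M := by
  obtain ⟨M, hM⟩ := isCompact_Icc.bddAbove_image (K := Icc 0 τ)
    (hφ.continuous.comp (continuous_const_mul a)).continuousOn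
  exact ⟨max 1 M, le_max_left _ _, fun t ht => le_max_of_le_right (hM ⟨t, ht, rfl⟩)⟩

end IsPhi

section Direct

variable {p : ℝ} {lam : ℤ → ℝ} {φ : ℝ → ℝ} {τ : ℝ} {n : ℕ}

theorem tsum_le_genModulus_rpow (hp : 0 < p) (hlam : IsExponentSeq lam) (hn : 1 ≤ n) (f : ℝ → ℂ)
    {t : ℝ} (ht : t ∈ Icc 0 τ) :
    ∑' k : ℤ, ENNReal.ofReal (φ (lam k / lam n * t)) ^ p * ‖fourierCoef f (lam k)‖ₑ ^ p ≤
      genModulus p lam φ f (τ / lam n) ^ p := by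
  have hpos := hlam.natCast_pos hn
  rw [← ENNReal.rpow_inv_le_iff hp, ← one_div]
  have hmem : t / lam n ∈ Icc (-(τ / lam n)) (τ / lam n) := by
    have h1 : 0 ≤ t / lam n := div_nonneg ht.1 hpos.le
    have h2 : t / lam n ≤ τ / lam n := div_le_div_of_nonneg_right ht.2 hpos.le
    exact ⟨by linarith, h2⟩
  refine le_trans (le_of_eq ?_) (le_iSup₂ (t / lam n) hmem)
  simp only [div_mul_eq_mul_div, mul_div_assoc]

theorem jacksonI_le (hφ : IsPhi φ) (hlam : IsExponentSeq lam) (v : Weight τ) {k : ℤ}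
    (hk : n ≤ k.natAbs) :
    jacksonI p lam φ n v ≤
      ∫⁻ t in Icc 0 τ, ENNReal.ofReal (φ (lam k / lam n * t)) ^ p ∂v.measure := by
  refine (iInf₂_le k.natAbs hk).trans (le_of_eq ?_)
  refine lintegral_congr fun t => ?_
  have : φ (lam (k.natAbs : ℤ) * t / lam n) = φ (lam k / lam n * t) := by
    refine hφ.abs_eq ?_
    rcases hlam.apply_natAbs k with h | h <;> rw [h]
    · left; ring
    · right; ring
  rw [this]

theorem tail_mul_jacksonI_le (hp : 0 < p) (hlam : IsExponentSeq lam) (hφ : IsPhi φ) (hn : 1 ≤ n)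
    (f : ℝ → ℂ) (v : Weight τ) :
    (∑' k : ℤ, if n ≤ k.natAbs then ‖fourierCoef f (lam k)‖ₑ ^ p else 0) * jacksonI p lam φ n v ≤
      genModulus p lam φ f (τ / lam n) ^ p * ENNReal.ofReal (v.toFun τ - v.toFun 0) := by
  rw [← ENNReal.tsum_mul_right]
  calc _ ≤ ∑' k : ℤ, ∫⁻ t in Icc 0 τ,
        ENNReal.ofReal (φ (lam k / lam n * t)) ^ p * ‖fourierCoef f (lam k)‖ₑ ^ p ∂v.measure := by
        refine ENNReal.tsum_le_tsum fun k => ?_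
        rw [lintegral_mul_const _ (hφ.measurable_rpow p _)]
        split_ifs with hk
        · rw [mul_comm]
          gcongr
          exact jacksonI_le hφ hlam v hk
        · simp
    _ = ∫⁻ t in Icc 0 τ, ∑' k : ℤ,
        ENNReal.ofReal (φ (lam k / lam n * t)) ^ p * ‖fourierCoef f (lam k)‖ₑ ^ p ∂v.measure :=
        (lintegral_tsum fun k => ((hφ.measurable_rpow p _).mul_const _).aemeasurable).symm
    _ ≤ ∫⁻ t in Icc 0 τ, genModulus p lam φ f (τ / lam n) ^ p ∂v.measure :=
        setLIntegral_mono measurable_const fun t ht => tsum_le_genModulus_rpow hp hlam hn f ht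
    _ ≤ _ := by
        rw [setLIntegral_const]
        gcongr
        exact v.measure_Icc_le

theorem exists_jacksonI_le (hp : 0 < p) (hlam : IsExponentSeq lam) (hφ : IsPhi φ) :
    ∃ M : ℝ≥0∞, M ≠ ∞ ∧ ∀ v : Weight τ,
      jacksonI p lam φ n v ≤ M * ENNReal.ofReal (v.toFun τ - v.toFun 0) := by
  obtain ⟨M, hM, hφM⟩ := hφ.exists_bound (lam n / lam n) τ
  refine ⟨ENNReal.ofReal M ^ p, ?_, fun v => ?_⟩
  · exact ENNReal.rpow_ne_top_of_nonneg hp.le ENNReal.ofReal_ne_top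
  · refine (jacksonI_le hφ hlam v (k := n) (by simp)).trans ?_
    calc _ ≤ ∫⁻ t in Icc 0 τ, ENNReal.ofReal M ^ p ∂v.measure :=
          setLIntegral_mono measurable_const fun t ht =>
            ENNReal.rpow_le_rpow (ENNReal.ofReal_le_ofReal (hφM t ht)) hp.le
      _ ≤ _ := by
          rw [setLIntegral_const]
          gcongr
          exact v.measure_Icc_le

theorem tail_eq_zero_of_genModulus_eq_zero (hp : 0 < p) (hlam : IsExponentSeq lam) (hφ : IsPhi φ)
    (hn : 1 ≤ n) (hτ : 0 < τ) (f : ℝ → ℂ) (h0 : genModulus p lam φ f (τ / lam n) = 0) :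
    (∑' k : ℤ, if n ≤ k.natAbs then ‖fourierCoef f (lam k)‖ₑ ^ p else 0) = 0 := by
  have hpos := hlam.natCast_pos hn
  rw [ENNReal.tsum_eq_zero]
  intro k
  split_ifs with hk
  swap
  · rfl
  by_contra hne
  have hkn : lam n ≤ lam k.natAbs := hlam.strictMono.monotone (by omega)
  suffices h : Icc (0 : ℝ) τ ⊆ {t | φ t = 0} by
    have := measure_mono_null h hφ.null
    rw [Real.volume_Icc, ENNReal.ofReal_eq_zero] at this
    linarith
  intro x hx
  have hkpos : 0 < lam k.natAbs := hpos.trans_le hkn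
  have ht : lam n / lam k.natAbs * x ∈ Icc 0 τ := by
    have h1 : lam n / lam k.natAbs ≤ 1 := div_le_one_of_le₀ hkn hkpos.le
    have h2 : 0 ≤ lam n / lam k.natAbs := by positivity
    exact ⟨mul_nonneg h2 hx.1, (mul_le_of_le_one_left hx.1 h1).trans hx.2⟩
  have h1 := tsum_le_genModulus_rpow (φ := φ) hp hlam hn f ht
  rw [h0, ENNReal.zero_rpow_of_pos hp, nonpos_iff_eq_zero, ENNReal.tsum_eq_zero] at h1
  have h2 := (mul_eq_zero.1 (h1 k)).resolve_right hne
  rw [ENNReal.rpow_eq_zero_iff_of_pos hp, ENNReal.ofReal_eq_zero] at h2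
  have h3 : φ (lam k / lam n * (lam n / lam k.natAbs * x)) = φ x := by
    refine hφ.abs_eq ?_
    rcases hlam.apply_natAbs k with h | h
    · left; rw [← h]; field_simp
    · right
      rw [show lam k = -lam k.natAbs by linarith]; field_simp
  rw [h3] at h2
  exact le_antisymm h2 (hφ.nonneg x)

theorem bestApprox_le_jacksonC_mul (hp : 0 < p) (hlam : IsExponentSeq lam) (hφ : IsPhi φ)
    (hn : 1 ≤ n) (hτ : 0 < τ) {f : ℝ → ℂ} (hf : f ∈ BSOn p lam) :
    bestApprox p (lam n) f ≤ jacksonC p lam φ n τ * genModulus p lam φ f (τ / lam n) := by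
  rw [bestApprox_eq hp hlam n hf, jacksonC]
  set E := ∑' k : ℤ, if n ≤ k.natAbs then ‖fourierCoef f (lam k)‖ₑ ^ p else 0 with hE
  set ω := genModulus p lam φ f (τ / lam n) with hω
  rw [one_div, ENNReal.rpow_inv_le_iff hp, ENNReal.mul_rpow_of_nonneg _ _ hp.le,
    ENNReal.rpow_inv_rpow hp.ne']
  obtain ⟨M, hMtop, hM⟩ := exists_jacksonI_le (n := n) (τ := τ) hp hlam hφ
  have hmass : ∀ v : Weight τ, ENNReal.ofReal (v.toFun τ - v.toFun 0) ≠ 0 := fun v => by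
    simpa using v.lt
  rcases eq_or_ne ω 0 with h0 | h0
  · rw [hE, tail_eq_zero_of_genModulus_eq_zero hp hlam hφ hn hτ f h0]; exact zero_le
  have hω0 : ω ^ p ≠ 0 := by simp [h0, hp.le]
  rcases eq_or_ne (ω ^ p) ∞ with htop | htop
  · rw [htop, ENNReal.mul_top]
    · exact le_top
    · refine (lt_of_lt_of_le (ENNReal.inv_pos.2 hMtop) (le_iInf fun v => ?_)).ne'
      refine ENNReal.le_div_iff_mul_le (.inr (hmass v)) (.inr ENNReal.ofReal_ne_top) |>.2 ?_
      rw [mul_comm, ← div_eq_mul_inv]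
      exact ENNReal.div_le_of_le_mul' (hM v)
  rw [← ENNReal.div_le_iff_le_mul (.inl hω0) (.inl htop)]
  refine le_iInf fun v => ?_
  have hI : jacksonI p lam φ n v ≠ ∞ :=
    ne_top_of_le_ne_top (ENNReal.mul_ne_top hMtop ENNReal.ofReal_ne_top) (hM v)
  refine ENNReal.le_div_iff_mul_le (.inr (hmass v)) (.inl hI) |>.2 ?_
  rw [div_eq_mul_inv, mul_right_comm, ← div_eq_mul_inv]
  exact ENNReal.div_le_of_le_mul' (tail_mul_jacksonI_le hp hlam hφ hn f v)

end Direct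

/-! ### Extremal functions -/

section Extremal

variable {p : ℝ} {lam : ℤ → ℝ} {φ : ℝ → ℝ} {τ : ℝ} {n : ℕ}

/-- Prescribed summable nonnegative coefficients at the exponents `λ_k`, `k ≥ 0`, are the Fourier
coefficients of a function of `BS^p`. -/
theorem exists_mem_BSExact (hp : 1 ≤ p) (hlam : IsExponentSeq lam) {c : ℕ → ℝ} (h0 : c 0 = 0)
    (hpos : ∀ k, 0 < k → 0 < c k) (hc : Summable c) :
    ∃ f ∈ BSExact p lam, ∀ G : ℤ → ℝ≥0∞,
      ∑' k : ℤ, G k * ‖fourierCoef f (lam k)‖ₑ ^ p = ∑' k : ℕ, G k * ENNReal.ofReal (c k) ^ p := by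
  have hp0 : 0 < p := by linarith
  have hnn : ∀ k, 0 ≤ c k := fun k => by
    rcases Nat.eq_zero_or_pos k with rfl | hk
    · exact h0.ge
    · exact (hpos k hk).le
  have hinj : Function.Injective fun k : ℕ => lam k :=
    hlam.strictMono.injective.comp Nat.cast_injective
  obtain ⟨hbap, hcoef⟩ := isBap_tsum (c := fun k => (c k : ℂ))
    (by simpa [abs_of_nonneg (hnn _)] using hc) (fun k : ℕ => lam k)
  set f := fun x : ℝ => ∑' k : ℕ, (c k : ℂ) * Complex.exp (Complex.I * (lam k : ℂ) * (x : ℂ))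
  have hA : ∀ k : ℕ, fourierCoef f (lam k) = c k := fun k => by
    refine (hcoef (lam k)).unique ?_
    refine (hasSum_ite_eq k (c k : ℂ)).congr_fun fun j => ?_
    by_cases hj : j = k
    · subst hj; simp
    · rw [if_neg hj, if_neg fun h => hj (hinj h)]
  have hB : ∀ ξ, ξ ∉ range (fun k : ℕ => lam k) → fourierCoef f ξ = 0 := fun ξ hξ => by
    refine (hcoef ξ).unique ?_
    convert hasSum_zero with k
    exact if_neg fun h => hξ ⟨k, h⟩
  have hAe : ∀ k : ℕ, ‖fourierCoef f (lam k)‖ₑ = ENNReal.ofReal (c k) := fun k => by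
    rw [hA, ← ofReal_norm, Complex.norm_real, Real.norm_of_nonneg (hnn k)]
  refine ⟨f, ⟨⟨⟨hbap, ?_⟩, fun ξ hξ => ?_⟩, fun k hk => ?_⟩, fun G => ?_⟩
  · refine ENNReal.rpow_lt_top_of_nonneg (by positivity) ?_
    rw [← hinj.tsum_eq]
    · simp only [hAe]
      simp only [ENNReal.ofReal_rpow_of_nonneg (hnn _) hp0.le]
      have hs : Summable fun k => c k ^ p := by
        refine hc.of_norm_bounded_eventually_nat (g := c) ?_
        filter_upwards [hc.tendsto_atTop_zero.eventually_le_const zero_lt_one] with k hk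
        rw [Real.norm_of_nonneg (Real.rpow_nonneg (hnn k) p)]
        rcases (hnn k).eq_or_lt with h | h
        · rw [← h, Real.zero_rpow hp0.ne']
        · simpa using Real.rpow_le_rpow_of_exponent_ge h hk hp
      exact hs.tsum_ofReal_ne_top
    · intro ξ hξ
      by_contra h
      exact hξ (by simp [hB ξ h, hp0])
  · by_contra h
    exact hξ (hB ξ fun ⟨k, hk⟩ => h ⟨k, hk⟩)
  · lift k to ℕ using hk.le
    have h1 := hpos k (by exact_mod_cast hk)
    rw [hA, Complex.norm_real, Real.norm_of_nonneg h1.le]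
    positivity
  · rw [← (Nat.cast_injective (R := ℤ)).tsum_eq]
    · simp only [hAe]
    · intro k hk
      by_contra h
      refine hk ?_
      dsimp only
      rw [hB (lam k), enorm_zero, ENNReal.zero_rpow_of_pos hp0, mul_zero]
      rintro ⟨j, hj⟩
      exact h ⟨j, hlam.strictMono.injective hj⟩

theorem inv_jacksonK_rpow_le (hp : 1 ≤ p) (hlam : IsExponentSeq lam) (hφ : IsPhi φ) (hn : 1 ≤ n)
    (s : Finset ℕ) (hs : ∀ k ∈ s, n ≤ k) (a : ℕ → ℝ) (ha : ∀ k, 0 ≤ a k)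
    (has : ∀ k, k ∉ s → a k = 0) (ha1 : ∑ k ∈ s, a k = 1) {r : ℝ}
    (hr : ∀ t ∈ Icc 0 τ, ∑ k ∈ s, a k * φ (lam k / lam n * t) ^ p ≤ r) :
    (jacksonK p lam φ n τ (BSExact p lam) ^ p)⁻¹ ≤ ENNReal.ofReal r := by
  have hp0 : 0 < p := by linarith
  have hpos := hlam.natCast_pos hn
  have key : ∀ ε ∈ Ioc (0 : ℝ) 1,
      (jacksonK p lam φ n τ (BSExact p lam) ^ p)⁻¹ ≤ ENNReal.ofReal (r + ε) := by
    intro ε hε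
    choose M hM1 hM using fun k : ℕ => hφ.exists_bound (lam k / lam n) τ
    have hMp : ∀ k, 1 ≤ M k ^ p := fun k => Real.one_le_rpow (hM1 k) hp0.le
    let e : ℕ → ℝ := fun k => ε / 2 / 2 ^ k / M k ^ p
    have he0 : ∀ k, 0 < e k := fun k => by
      have := hε.1
      have := hMp k
      positivity
    have hgeo := hasSum_geometric_two' ε
    have hele : ∀ k, e k ≤ ε / 2 / 2 ^ k := fun k =>
      div_le_self (by have := hε.1; positivity) (hMp k)
    have he1 : ∀ k, e k ≤ 1 := fun k => by
      refine (hele k).trans ?_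
      have h1 : ε / 2 ≤ 1 := by linarith [hε.1, hε.2]
      exact div_le_one_of_le₀ (h1.trans (one_le_pow₀ (by norm_num))) (by positivity)
    have hep : ∀ k, e k ^ p ≤ e k := fun k => by
      simpa using Real.rpow_le_rpow_of_exponent_ge (he0 k) (he1 k) hp
    let c : ℕ → ℝ := fun k => if k = 0 then 0 else max (a k ^ (1 / p)) (e k)
    have hcnn : ∀ k, 0 ≤ c k := fun k => by
      dsimp only [c]; split_ifs
      · exact le_rfl
      · exact le_max_of_le_right (he0 k).le
    have hap : ∀ k, (a k ^ (1 / p)) ^ p = a k := fun k => by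
      rw [one_div, Real.rpow_inv_rpow (ha k) hp0.ne']
    have hcp : ∀ k, c k ^ p ≤ a k + e k := fun k => by
      dsimp only [c]; split_ifs
      · rw [Real.zero_rpow hp0.ne']; exact add_nonneg (ha k) (he0 k).le
      · rcases max_choice (a k ^ (1 / p)) (e k) with h | h <;> rw [h]
        · rw [hap]; linarith [he0 k]
        · linarith [hep k, ha k]
    have hcsum : Summable c := by
      have h1 : Summable fun k => a k ^ (1 / p) := by
        refine summable_of_ne_finset_zero (s := s) fun k hk => ?_
        rw [has k hk, Real.zero_rpow (by positivity)]
      have h2 : Summable e := Summable.of_nonneg_of_le (fun k => (he0 k).le) hele hgeo.summable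
      refine Summable.of_nonneg_of_le hcnn (fun k => ?_) (h1.add h2)
      have := Real.rpow_nonneg (ha k) (1 / p)
      dsimp only [c]; split_ifs
      · linarith [he0 k]
      · exact max_le (by linarith [he0 k]) (by linarith)
    obtain ⟨f, hf, hfsum⟩ := exists_mem_BSExact hp hlam (c := c) (by simp [c])
      (fun k hk => by simp only [c, hk.ne', if_false]; exact lt_max_of_lt_right (he0 k)) hcsum
    have hE : 1 ≤ bestApprox p (lam n) f := by
      rw [bestApprox_eq hp0 hlam n hf.1]
      refine ENNReal.one_le_rpow ?_ (by positivity)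
      have h1 := hfsum fun k => if n ≤ k.natAbs then 1 else 0
      simp only [ite_mul, one_mul, zero_mul, Int.natAbs_natCast] at h1
      rw [h1]
      refine le_trans ?_ (ENNReal.sum_le_tsum s)
      rw [← ENNReal.ofReal_one, ← ha1, ENNReal.ofReal_sum_of_nonneg fun k _ => ha k]
      refine Finset.sum_le_sum fun k hk => ?_
      have hkn := hs k hk
      rw [if_pos hkn, ENNReal.ofReal_rpow_of_nonneg (hcnn k) hp0.le]
      refine ENNReal.ofReal_le_ofReal ?_
      rw [← hap k]
      refine Real.rpow_le_rpow (Real.rpow_nonneg (ha k) _) ?_ hp0.le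
      simp only [c, show k ≠ 0 by omega, if_false]
      exact le_max_left _ _
    have hω : genModulus p lam φ f (τ / lam n) ^ p ≤ ENNReal.ofReal (r + ε) := by
      rw [← ENNReal.le_rpow_inv_iff hp0, ← one_div]
      refine iSup₂_le fun h hh => ENNReal.rpow_le_rpow ?_ (by positivity)
      have ht : |h| * lam n ∈ Icc 0 τ :=
        ⟨by positivity, by rw [← le_div_iff₀ hpos]; exact abs_le.2 hh⟩
      have hφh : ∀ k : ℤ, φ (lam k * h) = φ (lam k / lam n * (|h| * lam n)) := fun k => by
        refine hφ.abs_eq ?_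
        have : lam k / lam n * (|h| * lam n) = lam k * |h| := by field_simp
        rw [this]
        rcases abs_choice h with h1 | h1 <;> rw [h1]
        · left; rfl
        · right; ring
      set t := |h| * lam n
      rw [hfsum fun k => ENNReal.ofReal (φ (lam k * h)) ^ p]
      have hψ0 : ∀ k : ℕ, 0 ≤ φ (lam k / lam n * t) ^ p := fun k =>
        Real.rpow_nonneg (hφ.nonneg _) _
      have hsum := (hasSum_sum_of_ne_finset_zero (f := fun k : ℕ => a k * φ (lam k / lam n * t) ^ p)
        (s := s) (fun k hk => by rw [has k hk, zero_mul])).add hgeo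
      calc _ ≤ ∑' k : ℕ, ENNReal.ofReal (a k * φ (lam k / lam n * t) ^ p + ε / 2 / 2 ^ k) := by
            refine ENNReal.tsum_le_tsum fun k => ?_
            rw [hφh, ENNReal.ofReal_rpow_of_nonneg (hφ.nonneg _) hp0.le,
              ENNReal.ofReal_rpow_of_nonneg (hcnn k) hp0.le, ← ENNReal.ofReal_mul (hψ0 k)]
            refine ENNReal.ofReal_le_ofReal ?_
            have h1 : φ (lam k / lam n * t) ^ p ≤ M k ^ p :=
              Real.rpow_le_rpow (hφ.nonneg _) (hM k t ht) hp0.le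
            calc _ ≤ φ (lam k / lam n * t) ^ p * (a k + e k) :=
                  mul_le_mul_of_nonneg_left (hcp k) (hψ0 k)
              _ = a k * φ (lam k / lam n * t) ^ p + φ (lam k / lam n * t) ^ p * e k := by ring
              _ ≤ a k * φ (lam k / lam n * t) ^ p + M k ^ p * e k := by
                  gcongr
                  exact (he0 k).le
              _ = _ := by
                  have := hMp k
                  rw [mul_div_cancel₀ _ (by positivity)]
        _ = ENNReal.ofReal (∑ k ∈ s, a k * φ (lam k / lam n * t) ^ p + ε) := by
            rw [← ENNReal.ofReal_tsum_of_nonneg _ hsum.summable, hsum.tsum_eq]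
            intro k
            have := hε.1
            exact add_nonneg (mul_nonneg (ha k) (hψ0 k)) (by positivity)
        _ ≤ _ := ENNReal.ofReal_le_ofReal (by linarith [hr t ht])
    rw [ENNReal.inv_le_iff_inv_le]
    calc _ ≤ (genModulus p lam φ f (τ / lam n) ^ p)⁻¹ := ENNReal.inv_le_inv.2 hω
      _ = (1 / genModulus p lam φ f (τ / lam n)) ^ p := by rw [one_div, ENNReal.inv_rpow]
      _ ≤ (bestApprox p (lam n) f / genModulus p lam φ f (τ / lam n)) ^ p :=
          ENNReal.rpow_le_rpow (ENNReal.div_le_div_right hE _) hp0.le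
      _ ≤ _ := ENNReal.rpow_le_rpow (le_iSup₂ (f := fun f _ =>
          bestApprox p (lam n) f / genModulus p lam φ f (τ / lam n)) f hf) hp0.le
  have hlim : Tendsto (fun ε : ℝ => ENNReal.ofReal (r + ε)) (𝓝[>] 0) (𝓝 (ENNReal.ofReal r)) := by
    have : Continuous fun ε : ℝ => ENNReal.ofReal (r + ε) :=
      ENNReal.continuous_ofReal.comp (continuous_const_add r)
    simpa using (this.tendsto 0).mono_left nhdsWithin_le_nhds
  exact ge_of_tendsto hlim (by
    filter_upwards [Ioc_mem_nhdsGT zero_lt_one] with ε hε using key ε hε)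

/-- By the minimax principle, some weight does as well as the least constant on the functions with
full spectrum allows. -/
theorem exists_jacksonRatio_le (hp : 1 ≤ p) (hlam : IsExponentSeq lam) (hφ : IsPhi φ) (hn : 1 ≤ n)
    (hτ : 0 < τ) : ∃ v : Weight τ,
      jacksonRatio p lam φ n v ≤ jacksonK p lam φ n τ (BSExact p lam) ^ p := by
  have hp0 : 0 < p := by linarith
  set R := jacksonK p lam φ n τ (BSExact p lam) ^ p with hR
  rcases eq_or_ne R ∞ with htop | htop
  · obtain ⟨v, -⟩ := exists_weight_of_measure hτ (Measure.dirac τ) (by simp [hτ.le])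
    exact ⟨v, htop ▸ le_top⟩
  let ψ : ℕ → C(Icc 0 τ, ℝ) := fun i =>
    ⟨fun t => φ (lam (n + i : ℕ) / lam n * t) ^ p, by
      have := hφ.continuous
      exact Continuous.rpow_const (by fun_prop) fun _ => .inr hp0.le⟩
  have : Nonempty (Icc 0 τ) := ⟨⟨0, le_rfl, hτ.le⟩⟩
  have hlin : ∀ w : ℕ →₀ ℝ, (∀ i, 0 ≤ w i) →
      Finsupp.linearCombination ℝ (fun _ => (1 : ℝ)) w = 1 → ∀ r : ℝ,
      (∀ t, Finsupp.linearCombination ℝ ψ w t ≤ r) → R⁻¹ ≤ ENNReal.ofReal r := by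
    intro w hw hw1 r hr
    refine inv_jacksonK_rpow_le hp hlam hφ hn (w.support.map (addLeftEmbedding n)) ?_
      (fun k => if n ≤ k then w (k - n) else 0) ?_ ?_ ?_ ?_
    · simp only [Finset.mem_map, addLeftEmbedding_apply]
      rintro k ⟨i, -, rfl⟩
      omega
    · intro k
      split_ifs
      · exact hw _
      · exact le_rfl
    · intro k hk
      split_ifs with h
      · by_contra hne
        exact hk (Finset.mem_map.2 ⟨k - n, Finsupp.mem_support_iff.2 hne, by
          simp only [addLeftEmbedding_apply]; omega⟩)
      · rfl
    · rw [← hw1, Finsupp.linearCombination_apply, Finsupp.sum]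
      simp
    · intro t ht
      refine le_trans (le_of_eq ?_) (hr ⟨t, ht⟩)
      rw [Finsupp.linearCombination_apply, Finsupp.sum, ContinuousMap.sum_apply]
      simp [ψ]
  have hmax : ∀ w : ℕ →₀ ℝ, ∃ x, ∀ t,
      Finsupp.linearCombination ℝ ψ w t ≤ Finsupp.linearCombination ℝ ψ w x := fun w => by
    obtain ⟨x, -, hx⟩ := isCompact_univ.exists_isMaxOn univ_nonempty
      (Finsupp.linearCombination ℝ ψ w).continuous.continuousOn
    exact ⟨x, fun t => hx (mem_univ t)⟩
  have hRtop : R⁻¹ ≠ ∞ := by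
    obtain ⟨x, hx⟩ := hmax (Finsupp.single 0 1)
    refine ne_top_of_le_ne_top ENNReal.ofReal_ne_top (hlin (Finsupp.single 0 1) (fun i => ?_)
      (by simp) _ hx)
    rw [Finsupp.single_apply]; split_ifs <;> simp
  obtain ⟨μ, hμ, hint⟩ := exists_probabilityMeasure_forall_le_integral ψ (R⁻¹).toReal (by
    intro w hw hw1
    obtain ⟨x, hx⟩ := hmax w
    refine ⟨x, ?_⟩
    have h1 := hlin w hw hw1 _ hx
    refine ENNReal.toReal_le_of_le_ofReal ?_ h1
    rw [Finsupp.linearCombination_apply, Finsupp.sum, ContinuousMap.sum_apply]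
    exact Finset.sum_nonneg fun i _ => mul_nonneg (hw i) (Real.rpow_nonneg (hφ.nonneg _) _))
  have hμ' : IsProbabilityMeasure (μ.map Subtype.val) :=
    Measure.isProbabilityMeasure_map measurable_subtype_coe.aemeasurable
  obtain ⟨v, hv, hv1⟩ := exists_weight_of_measure hτ (μ.map Subtype.val) (by
    rw [Measure.map_apply measurable_subtype_coe measurableSet_Icc.compl]
    simp)
  refine ⟨v, ?_⟩
  have hI : R⁻¹ ≤ jacksonI p lam φ n v := by
    refine le_iInf₂ fun k hk => ?_
    obtain ⟨i, rfl⟩ := Nat.exists_eq_add_of_le hk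
    have hm : Measurable fun t : ℝ => ENNReal.ofReal (φ (lam (n + i : ℕ) * t / lam n)) ^ p := by
      simpa only [div_mul_eq_mul_div] using hφ.measurable_rpow p (lam (n + i : ℕ) / lam n)
    rw [hv, setLIntegral_map measurableSet_Icc hm measurable_subtype_coe,
      Subtype.coe_preimage_self, Measure.restrict_univ]
    have h1 : ∀ t : Icc 0 τ, ENNReal.ofReal (φ (lam (n + i : ℕ) * t / lam n)) ^ p =
        ENNReal.ofReal (ψ i t) := fun t => by
      rw [ENNReal.ofReal_rpow_of_nonneg (hφ.nonneg _) hp0.le, ← div_mul_eq_mul_div]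
      rfl
    simp only [h1]
    rw [← ofReal_integral_eq_lintegral_ofReal
      ((ψ i).continuous.integrable_of_hasCompactSupport (HasCompactSupport.of_compactSpace _))
      (Eventually.of_forall fun t => Real.rpow_nonneg (hφ.nonneg _) _),
      ← ENNReal.ofReal_toReal hRtop]
    exact ENNReal.ofReal_le_ofReal (hint i)
  rw [jacksonRatio, hv1, ENNReal.ofReal_one, one_div, ENNReal.inv_le_iff_inv_le]
  exact hI

end Extremal

theorem theorem1 (p : ℝ) (hp : 1 ≤ p) (lam : ℤ → ℝ) (hlam : IsExponentSeq lam)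
    (φ : ℝ → ℝ) (hφ : IsPhi φ) (τ : ℝ) (hτ : 0 < τ) (n : ℕ) (hn : 1 ≤ n) :
    (∀ f ∈ BSOn p lam,
      bestApprox p (lam n) f ≤ jacksonC p lam φ n τ * genModulus p lam φ f (τ / lam n)) ∧
    (∃ v : Weight τ, jacksonRatio p lam φ n v = ⨅ w : Weight τ, jacksonRatio p lam φ n w) ∧
    jacksonC p lam φ n τ = jacksonK p lam φ n τ (BSOn p lam) ∧
    jacksonC p lam φ n τ = jacksonK p lam φ n τ (BSExact p lam) := by
  have hp0 : 0 < p := by linarith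
  have direct : ∀ f ∈ BSOn p lam,
      bestApprox p (lam n) f ≤ jacksonC p lam φ n τ * genModulus p lam φ f (τ / lam n) :=
    fun f hf => bestApprox_le_jacksonC_mul hp0 hlam hφ hn hτ hf
  have hKC : jacksonK p lam φ n τ (BSOn p lam) ≤ jacksonC p lam φ n τ :=
    iSup₂_le fun f hf => ENNReal.div_le_of_le_mul (direct f hf)
  have hKK : jacksonK p lam φ n τ (BSExact p lam) ≤ jacksonK p lam φ n τ (BSOn p lam) :=
    biSup_mono fun f hf => hf.1
  obtain ⟨v, hv⟩ := exists_jacksonRatio_le hp hlam hφ hn hτ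
  have hvC : jacksonRatio p lam φ n v ≤ ⨅ w : Weight τ, jacksonRatio p lam φ n w := by
    refine hv.trans ((ENNReal.rpow_le_rpow (hKK.trans hKC) hp0.le).trans (le_of_eq ?_))
    rw [jacksonC, one_div, ENNReal.rpow_inv_rpow hp0.ne']
  have hCK : jacksonC p lam φ n τ ≤ jacksonK p lam φ n τ (BSExact p lam) := by
    rw [jacksonC, one_div, ENNReal.rpow_inv_le_iff hp0]
    exact (iInf_le _ v).trans hv
  exact ⟨direct, ⟨v, le_antisymm hvC (iInf_le _ v)⟩, le_antisymm (hCK.trans hKK) hKC,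
    le_antisymm hCK (hKK.trans hKC)⟩
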